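/- Let $\mathbb{D}$ be the open unit disc in $\mathbb{C}$, let $1 \le p < \infty$, let $\varphi, \psi$ be analytic functions on $\mathbb{D}$ with $\varphi(\mathbb{D}) \subset \mathbb{D}$, and let $W_{\varphi,\psi} f(z) = \psi(z) f(\varphi(z))$ for $f$ analytic on $\mathbb{D}$ and $z \in \mathbb{D}$. Let $H^p$ be the Hardy space of all analytic functions $f$ on $\mathbb{D}$ with $$\|f\|_{H^p}^p = \sup_{0<r<1} \frac{1}{2\pi}\int_0^{2\pi} |f(re^{i\theta})|^p \, d\theta < \infty,$$ let $S^p$ be the space of all analytic functions $f$ on $\mathbb{D}$ with $f' \in H^p$, with the norm $\|f\|_{S^p} = |f(0)| + \|f'\|_{H^p}$, and let $S_2^p$ be the space of all analytic functions $f$ on $\mathbb{D}$ with $f'' \in H^p$, with the norm $\|f\|_{S_2^p} = |f(0)| + |f'(0)| + \|f''\|_{H^p}$. Let $S$ be either of the spaces $S_2^p$ and $S^p$. Then $W_{\varphi,\psi}$ is a bounded operator from $S$ into $H^p$ (that is, it maps $S$ into $H^p$, and there is a finite constant $C$ with $\|W_{\varphi,\psi} f\|_{H^p} \le C \|f\|_S$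 for all $f \in S$) if and only if $\psi \in H^p$. -/

import Mathlib

open scoped ENNReal NNReal

/-- The open unit disc `𝔻` of the complex plane.  A function on `𝔻` is represented by a function
`ℂ → ℂ`, of which only the values on `𝔻` play a role in the definitions below. -/
def unitDisc : Set ℂ := Metric.ball 0 1

/-- `H(𝔻)`: the functions that are analytic (equivalently, complex differentiable) on `𝔻`. -/
def analyticOnDisc : Set (ℂ → ℂ) := {f | DifferentiableOn ℂ f unitDisc}

/-- The integral mean `M_r(f, p) = (1 / 2π) ∫_0^{2π} |f (r e^{iθ})| ^ p dθ`. -/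
noncomputable def integralMean (p : ℝ) (f : ℂ → ℂ) (r : ℝ) : ℝ :=
  (2 * Real.pi)⁻¹ * ∫ θ in (0 : ℝ)..(2 * Real.pi), ‖f (r * Complex.exp (θ * Complex.I))‖ ^ p

/-- The Hardy norm `(sup_{0 < r < 1} M_r(f, p)) ^ (1 / p)` of an analytic function on `𝔻`, with
the value `∞` when the supremum is infinite. -/
noncomputable def hardyNorm (p : ℝ) (f : ℂ → ℂ) : ℝ≥0∞ :=
  (⨆ r ∈ Set.Ioo (0 : ℝ) 1, ENNReal.ofReal (integralMean p f r)) ^ (1 / p)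

/-- The Hardy space `H^p`. -/
def hardySpace (p : ℝ) : Set (ℂ → ℂ) :=
  {f | f ∈ analyticOnDisc ∧ hardyNorm p f < ∞}

/-- The space `S^p`: the analytic functions on `𝔻` with derivative in `H^p`. -/
def derivHardySpace (p : ℝ) : Set (ℂ → ℂ) :=
  {f | f ∈ analyticOnDisc ∧ deriv f ∈ hardySpace p}

/-- The norm `‖f‖ = |f(0)| + ‖f'‖_{H^p}` of `S^p`. -/
noncomputable def derivHardyNorm (p : ℝ) (f : ℂ → ℂ) : ℝ≥0∞ :=
  ‖f 0‖ₑ + hardyNorm p (deriv f)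

/-- The space `S_2^p`: the analytic functions on `𝔻` with second derivative in `H^p`. -/
def secondDerivHardySpace (p : ℝ) : Set (ℂ → ℂ) :=
  {f | f ∈ analyticOnDisc ∧ deriv (deriv f) ∈ hardySpace p}

/-- The norm `‖f‖ = |f(0)| + |f'(0)| + ‖f''‖_{H^p}` of `S_2^p`. -/
noncomputable def secondDerivHardyNorm (p : ℝ) (f : ℂ → ℂ) : ℝ≥0∞ :=
  ‖f 0‖ₑ + ‖deriv f 0‖ₑ + hardyNorm p (deriv (deriv f))

/-- The weighted composition operator `W_{φ, ψ} f (z) = ψ(z) f(φ(z))`. -/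
def weightedComp (φ ψ : ℂ → ℂ) (f : ℂ → ℂ) : ℂ → ℂ :=
  fun z => ψ z * f (φ z)

/-- A (linear) operator `T` is bounded from the space `X` with norm `NX` into the space `Y` with
norm `NY`: it maps `X` into `Y`, and `‖T f‖_Y ≤ C ‖f‖_X` on `X` for some finite constant `C`. -/
def IsBoundedBetween (X : Set (ℂ → ℂ)) (NX : (ℂ → ℂ) → ℝ≥0∞)
    (Y : Set (ℂ → ℂ)) (NY : (ℂ → ℂ) → ℝ≥0∞) (T : (ℂ → ℂ) → (ℂ → ℂ)) : Prop :=
  (∀ f ∈ X, T f ∈ Y) ∧ ∃ C : ℝ≥0, ∀ f ∈ X, NY (T f) ≤ C * NX f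

/-!
The space `S_2^p` embeds boundedly into `S^p`, and `S^p` into `H^∞`, while for `ψ ∈ H^p` the operator
`W_{φ, ψ}` is bounded from `H^∞` into `H^p`. Conversely, `W_{φ, ψ} 1 = ψ`.

For the embedding of `S^p` into `H^∞`, two values of `f` on a circle `|w| = r` differ by at most
the length `∫ |f' (r e^{iθ})| r dθ ≤ 2π ‖f'‖_{H^1}` of the image curve. By the maximum modulus
principle the same bound holds for `|f z - f 0|` with `|z| = r`, and `‖f'‖_{H^1} ≤ ‖f'‖_{H^p}`.
-/

open MeasureTheory ProbabilityTheory Metric Set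

/-- The normalized arc length `dθ / 2π` on a circle, as a probability measure in the angle `θ`. -/
noncomputable def angleMeasure : Measure ℝ := volume[|Ioc 0 (2 * Real.pi)]

instance : IsProbabilityMeasure angleMeasure :=
  cond_isProbabilityMeasure_of_finite (by simp [Real.pi_pos]) measure_Ioc_lt_top.ne

lemma setLIntegral_Icc_zero_two_pi (g : ℝ → ℝ≥0∞) :
    ∫⁻ θ in Icc 0 (2 * Real.pi), g θ =
      ENNReal.ofReal (2 * Real.pi) * ∫⁻ θ, g θ ∂angleMeasure := by
  have hne : ENNReal.ofReal (2 * Real.pi) ≠ 0 := by simp [Real.pi_pos]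
  rw [angleMeasure, ProbabilityTheory.cond, lintegral_smul_measure, smul_eq_mul, Real.volume_Ioc,
    sub_zero, ← mul_assoc, ENNReal.mul_inv_cancel hne ENNReal.ofReal_ne_top, one_mul,
    restrict_Ioc_eq_restrict_Icc]

lemma integralMean_eq_integral_angleMeasure (p : ℝ) (f : ℂ → ℂ) (r : ℝ) :
    integralMean p f r = ∫ θ, ‖f (circleMap 0 r θ)‖ ^ p ∂angleMeasure := by
  rw [angleMeasure, ProbabilityTheory.cond, integral_smul_measure, Real.volume_Ioc, sub_zero,
    ENNReal.toReal_inv, ENNReal.toReal_ofReal Real.two_pi_pos.le, integralMean,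
    intervalIntegral.integral_of_le Real.two_pi_pos.le]
  simp [circleMap]

lemma circleMap_mem_unitDisc {r : ℝ} (hr : r ∈ Ioo (0 : ℝ) 1) (θ : ℝ) :
    circleMap 0 r θ ∈ unitDisc := by
  simp [unitDisc, abs_of_pos hr.1, hr.2]

lemma deriv_mem_analyticOnDisc {f : ℂ → ℂ} (hf : f ∈ analyticOnDisc) :
    deriv f ∈ analyticOnDisc :=
  DifferentiableOn.deriv hf isOpen_ball

lemma continuous_comp_circleMap {f : ℂ → ℂ} (hf : f ∈ analyticOnDisc) {r : ℝ}
    (hr : r ∈ Ioo (0 : ℝ) 1) : Continuous fun θ => f (circleMap 0 r θ) :=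
  ContinuousOn.comp_continuous (DifferentiableOn.continuousOn hf) (continuous_circleMap 0 r)
    (circleMap_mem_unitDisc hr)

/-- The norm `sup_{z ∈ 𝔻} |f z|` of `H^∞`, with the value `∞` for unbounded functions. -/
noncomputable def hardyNormTop (f : ℂ → ℂ) : ℝ≥0∞ := ⨆ z ∈ unitDisc, ‖f z‖ₑ

/-- The space `H^∞` of bounded analytic functions on `𝔻`. -/
def hardySpaceTop : Set (ℂ → ℂ) := {f | f ∈ analyticOnDisc ∧ hardyNormTop f < ∞}

lemma enorm_le_hardyNormTop {f : ℂ → ℂ} {z : ℂ} (hz : z ∈ unitDisc) : ‖f z‖ₑ ≤ hardyNormTop f :=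
  le_iSup₂ (f := fun z (_ : z ∈ unitDisc) => ‖f z‖ₑ) z hz

lemma hardyNormTop_comp_le {φ : ℂ → ℂ} (hφ : MapsTo φ unitDisc unitDisc) (f : ℂ → ℂ) :
    hardyNormTop (f ∘ φ) ≤ hardyNormTop f :=
  iSup₂_le fun _ hz => enorm_le_hardyNormTop (hφ hz)

lemma eLpNorm_top_comp_circleMap_le_hardyNormTop {f : ℂ → ℂ} {r : ℝ} (hr : r ∈ Ioo (0 : ℝ) 1) :
    eLpNorm (fun θ => f (circleMap 0 r θ)) ∞ angleMeasure ≤ hardyNormTop f := by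
  rw [eLpNorm_exponent_top]
  exact eLpNormEssSup_le_of_ae_enorm_bound
    (.of_forall fun θ => enorm_le_hardyNormTop (circleMap_mem_unitDisc hr θ))

section HardyNorm

variable {p : ℝ} {f g : ℂ → ℂ} {r : ℝ}

lemma memLp_comp_circleMap (hf : f ∈ analyticOnDisc) (hr : r ∈ Ioo (0 : ℝ) 1) (q : ℝ≥0∞) :
    MemLp (fun θ => f (circleMap 0 r θ)) q angleMeasure := by
  have hcompact : IsCompact (range (circleMap 0 r)) := by
    rw [range_circleMap]
    exact isCompact_sphere 0 |r|
  have hcont : ContinuousOn f (range (circleMap 0 r)) :=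
    (DifferentiableOn.continuousOn hf).mono (range_subset_iff.2 (circleMap_mem_unitDisc hr))
  obtain ⟨M, hM⟩ := hcompact.exists_bound_of_continuousOn hcont
  exact .of_bound (continuous_comp_circleMap hf hr).aestronglyMeasurable M
    (.of_forall fun θ => hM _ (mem_range_self θ))

lemma ofReal_integralMean_rpow_eq_eLpNorm (hp : 0 < p) (hf : f ∈ analyticOnDisc)
    (hr : r ∈ Ioo (0 : ℝ) 1) :
    ENNReal.ofReal (integralMean p f r) ^ (1 / p) =
      eLpNorm (fun θ => f (circleMap 0 r θ)) (ENNReal.ofReal p) angleMeasure := by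
  have hmean : 0 ≤ ∫ θ, ‖f (circleMap 0 r θ)‖ ^ p ∂angleMeasure := by positivity
  rw [(memLp_comp_circleMap hf hr _).eLpNorm_eq_integral_rpow_norm (by simpa using hp) (by simp),
    ENNReal.toReal_ofReal hp.le, integralMean_eq_integral_angleMeasure, one_div,
    ENNReal.ofReal_rpow_of_nonneg hmean (by positivity)]

lemma hardyNorm_eq_iSup_eLpNorm (hp : 0 < p) (hf : f ∈ analyticOnDisc) :
    hardyNorm p f = ⨆ r ∈ Ioo (0 : ℝ) 1,
      eLpNorm (fun θ => f (circleMap 0 r θ)) (ENNReal.ofReal p) angleMeasure := by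
  rw [hardyNorm, ← ENNReal.orderIsoRpow_apply _ (one_div_pos.2 hp)]
  simp only [OrderIso.map_iSup, ENNReal.orderIsoRpow_apply]
  exact iSup_congr fun r => iSup_congr fun hr => ofReal_integralMean_rpow_eq_eLpNorm hp hf hr

lemma eLpNorm_comp_circleMap_le_hardyNorm (hp : 0 < p) (hf : f ∈ analyticOnDisc)
    (hr : r ∈ Ioo (0 : ℝ) 1) :
    eLpNorm (fun θ => f (circleMap 0 r θ)) (ENNReal.ofReal p) angleMeasure ≤ hardyNorm p f := by
  rw [hardyNorm_eq_iSup_eLpNorm hp hf]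
  exact le_iSup₂ (f := fun r (_ : r ∈ Ioo (0 : ℝ) 1) =>
    eLpNorm (fun θ => f (circleMap 0 r θ)) (ENNReal.ofReal p) angleMeasure) r hr

lemma hardyNorm_mono_exponent {q : ℝ} (hp : 0 < p) (hpq : p ≤ q) (hf : f ∈ analyticOnDisc) :
    hardyNorm p f ≤ hardyNorm q f := by
  rw [hardyNorm_eq_iSup_eLpNorm hp hf]
  refine iSup₂_le fun r hr => ?_
  exact (eLpNorm_le_eLpNorm_of_exponent_le (ENNReal.ofReal_le_ofReal hpq)
    (continuous_comp_circleMap hf hr).aestronglyMeasurable).trans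
      (eLpNorm_comp_circleMap_le_hardyNorm (hp.trans_le hpq) hf hr)

lemma hardyNorm_le_hardyNormTop (hp : 0 < p) (hf : f ∈ analyticOnDisc) :
    hardyNorm p f ≤ hardyNormTop f := by
  rw [hardyNorm_eq_iSup_eLpNorm hp hf]
  refine iSup₂_le fun r hr => ?_
  exact (eLpNorm_le_eLpNorm_of_exponent_le le_top
    (continuous_comp_circleMap hf hr).aestronglyMeasurable).trans
      (eLpNorm_top_comp_circleMap_le_hardyNormTop hr)

lemma hardyNorm_mul_le (hp : 0 < p) (hf : f ∈ analyticOnDisc) (hg : g ∈ analyticOnDisc) :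
    hardyNorm p (f * g) ≤ hardyNorm p f * hardyNormTop g := by
  rw [hardyNorm_eq_iSup_eLpNorm hp (DifferentiableOn.mul hf hg)]
  refine iSup₂_le fun r hr => ?_
  calc eLpNorm ((fun θ => f (circleMap 0 r θ)) • fun θ => g (circleMap 0 r θ))
        (ENNReal.ofReal p) angleMeasure
      ≤ eLpNorm (fun θ => f (circleMap 0 r θ)) (ENNReal.ofReal p) angleMeasure *
          eLpNorm (fun θ => g (circleMap 0 r θ)) ∞ angleMeasure :=
        eLpNorm_smul_le_eLpNorm_mul_eLpNorm_top _ _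
          (continuous_comp_circleMap hf hr).aestronglyMeasurable
    _ ≤ hardyNorm p f * hardyNormTop g := by
        gcongr
        · exact eLpNorm_comp_circleMap_le_hardyNorm hp hf hr
        · exact eLpNorm_top_comp_circleMap_le_hardyNormTop hr

end HardyNorm

section Oscillation

variable {E : Type*} [NormedAddCommGroup E] [NormedSpace ℂ E] {f : ℂ → E} {c : ℂ} {r : ℝ}

lemma enorm_deriv_comp_circleMap {θ : ℝ} (hf : DifferentiableAt ℂ f (circleMap c r θ)) :
    ‖deriv (fun θ => f (circleMap c r θ)) θ‖ₑ = ‖r‖ₑ * ‖deriv f (circleMap c r θ)‖ₑ := by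
  have hderiv : HasDerivAt (fun θ => f (circleMap c r θ))
      ((circleMap 0 r θ * Complex.I) • deriv f (circleMap c r θ)) θ :=
    hf.hasDerivAt.scomp θ (hasDerivAt_circleMap c r θ)
  rw [hderiv.deriv, enorm_smul]
  simp [← ofReal_norm]

lemma enorm_center_le_of_forall_mem_sphere_enorm_le (hr : 0 < r)
    (hf : DiffContOnCl ℂ f (ball c r)) {K : ℝ≥0∞} (hK : ∀ w ∈ sphere c r, ‖f w‖ₑ ≤ K) :
    ‖f c‖ₑ ≤ K := by
  rcases eq_or_ne K ∞ with rfl | hK_top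
  · exact le_top
  lift K to ℝ≥0 using hK_top
  simp only [enorm_le_coe, ← NNReal.coe_le_coe, coe_nnnorm] at hK ⊢
  refine Complex.norm_le_of_forall_mem_frontier_norm_le isBounded_ball hf ?_
    (subset_closure (mem_ball_self hr))
  rwa [frontier_ball c hr.ne']

variable [CompleteSpace E] {U : Set ℂ} {z w : ℂ}

lemma enorm_sub_le_lintegral_deriv_of_mem_sphere (hU : IsOpen U) (hf : DifferentiableOn ℂ f U)
    (hs : sphere c |r| ⊆ U) (hz : z ∈ sphere c |r|) (hw : w ∈ sphere c |r|) :
    ‖f z - f w‖ₑ ≤ ‖r‖ₑ * ∫⁻ θ in Icc 0 (2 * Real.pi), ‖deriv f (circleMap c r θ)‖ₑ := by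
  obtain ⟨a, ha, rfl⟩ := image_circleMap_Ioc c r ▸ hz
  obtain ⟨b, hb, rfl⟩ := image_circleMap_Ioc c r ▸ hw
  wlog hba : b ≤ a generalizing a b
  · rw [enorm_sub_rev]
    exact this b hb hw a ha hz (le_of_not_ge hba)
  have hmem (θ : ℝ) : circleMap c r θ ∈ U := hs (circleMap_mem_sphere' c r θ)
  have hsmooth : ContDiff ℝ 1 fun θ => f (circleMap c r θ) :=
    ((hf.contDiffOn hU).restrict_scalars ℝ).comp_contDiff (contDiff_circleMap c r) hmem
  calc ‖f (circleMap c r a) - f (circleMap c r b)‖ₑ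
      ≤ ∫⁻ θ in Icc b a, ‖deriv (fun θ => f (circleMap c r θ)) θ‖ₑ :=
        enorm_sub_le_lintegral_deriv_of_contDiffOn_Icc hsmooth.contDiffOn hba
    _ ≤ ∫⁻ θ in Icc 0 (2 * Real.pi), ‖deriv (fun θ => f (circleMap c r θ)) θ‖ₑ :=
        lintegral_mono_set (Icc_subset_Icc hb.1.le ha.2)
    _ = ∫⁻ θ in Icc 0 (2 * Real.pi), ‖r‖ₑ * ‖deriv f (circleMap c r θ)‖ₑ :=
        lintegral_congr fun θ =>
          enorm_deriv_comp_circleMap (hf.differentiableAt (hU.mem_nhds (hmem θ)))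
    _ = ‖r‖ₑ * ∫⁻ θ in Icc 0 (2 * Real.pi), ‖deriv f (circleMap c r θ)‖ₑ :=
        lintegral_const_mul' _ _ enorm_ne_top

lemma enorm_sub_center_le_lintegral_deriv (hU : IsOpen U) (hf : DifferentiableOn ℂ f U)
    (hr : 0 < r) (hB : closedBall c r ⊆ U) (hz : z ∈ sphere c r) :
    ‖f z - f c‖ₑ ≤ ‖r‖ₑ * ∫⁻ θ in Icc 0 (2 * Real.pi), ‖deriv f (circleMap c r θ)‖ₑ := by
  have habs : |r| = r := abs_of_pos hr
  have hdiff : DiffContOnCl ℂ (fun w => f z - f w) (ball c r) := by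
    refine ((hf.mono ?_).const_sub (f z)).diffContOnCl
    rwa [closure_ball c hr.ne']
  refine enorm_center_le_of_forall_mem_sphere_enorm_le hr hdiff fun w hw => ?_
  exact enorm_sub_le_lintegral_deriv_of_mem_sphere hU hf
    (habs.symm ▸ sphere_subset_closedBall.trans hB) (habs.symm ▸ hz) (habs.symm ▸ hw)

end Oscillation

section Embeddings

variable {p : ℝ} {f : ℂ → ℂ}

lemma enorm_sub_zero_le_hardyNorm_one_deriv (hf : f ∈ analyticOnDisc) {z : ℂ}
    (hz : z ∈ unitDisc) :
    ‖f z - f 0‖ₑ ≤ ENNReal.ofReal (2 * Real.pi) * hardyNorm 1 (deriv f) := by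
  rcases eq_or_ne z 0 with rfl | hz₀
  · simp
  have hr : ‖z‖ ∈ Ioo (0 : ℝ) 1 := ⟨norm_pos_iff.2 hz₀, mem_ball_zero_iff.1 hz⟩
  have hr_le : ‖(‖z‖)‖ₑ ≤ 1 := by simpa [← ofReal_norm] using hr.2.le
  have hmean : ∫⁻ θ, ‖deriv f (circleMap 0 ‖z‖ θ)‖ₑ ∂angleMeasure ≤ hardyNorm 1 (deriv f) := by
    simpa only [ENNReal.ofReal_one, eLpNorm_one_eq_lintegral_enorm] using
      eLpNorm_comp_circleMap_le_hardyNorm one_pos (deriv_mem_analyticOnDisc hf) hr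
  calc ‖f z - f 0‖ₑ
      ≤ ‖(‖z‖)‖ₑ * ∫⁻ θ in Icc 0 (2 * Real.pi), ‖deriv f (circleMap 0 ‖z‖ θ)‖ₑ :=
        enorm_sub_center_le_lintegral_deriv isOpen_ball hf hr.1 (closedBall_subset_ball hr.2)
          (mem_sphere_zero_iff_norm.2 rfl)
    _ ≤ 1 * (ENNReal.ofReal (2 * Real.pi) * hardyNorm 1 (deriv f)) := by
        rw [setLIntegral_Icc_zero_two_pi]
        gcongr
    _ = ENNReal.ofReal (2 * Real.pi) * hardyNorm 1 (deriv f) := one_mul _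

lemma one_le_ofReal_two_pi : 1 ≤ ENNReal.ofReal (2 * Real.pi) :=
  ENNReal.one_le_ofReal.2 (by linarith [Real.pi_gt_three])

lemma hardyNormTop_le_derivHardyNorm (hp : 1 ≤ p) (hf : f ∈ analyticOnDisc) :
    hardyNormTop f ≤ ENNReal.ofReal (2 * Real.pi) * derivHardyNorm p f := by
  refine iSup₂_le fun z hz => ?_
  calc ‖f z‖ₑ = ‖f 0 + (f z - f 0)‖ₑ := by rw [add_sub_cancel]
    _ ≤ ‖f 0‖ₑ + ‖f z - f 0‖ₑ := enorm_add_le _ _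
    _ ≤ ‖f 0‖ₑ + ENNReal.ofReal (2 * Real.pi) * hardyNorm p (deriv f) := by
        grw [enorm_sub_zero_le_hardyNorm_one_deriv hf hz,
          hardyNorm_mono_exponent one_pos hp (deriv_mem_analyticOnDisc hf)]
    _ ≤ ENNReal.ofReal (2 * Real.pi) * derivHardyNorm p f := by
        rw [derivHardyNorm, mul_add]
        gcongr
        exact le_mul_of_one_le_left' one_le_ofReal_two_pi

lemma derivHardyNorm_le_secondDerivHardyNorm (hp : 1 ≤ p) (hf : f ∈ analyticOnDisc) :
    derivHardyNorm p f ≤ ENNReal.ofReal (2 * Real.pi) * secondDerivHardyNorm p f := by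
  have hf' : deriv f ∈ analyticOnDisc := deriv_mem_analyticOnDisc hf
  calc derivHardyNorm p f
      ≤ ‖f 0‖ₑ + hardyNormTop (deriv f) :=
        add_le_add_right (hardyNorm_le_hardyNormTop (one_pos.trans_le hp) hf') _
    _ ≤ ‖f 0‖ₑ + ENNReal.ofReal (2 * Real.pi) * derivHardyNorm p (deriv f) := by
        grw [hardyNormTop_le_derivHardyNorm hp hf']
    _ ≤ ENNReal.ofReal (2 * Real.pi) * secondDerivHardyNorm p f := by
        rw [secondDerivHardyNorm, add_assoc, mul_add, derivHardyNorm]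
        gcongr
        exact le_mul_of_one_le_left' one_le_ofReal_two_pi

lemma derivHardyNorm_lt_top (hf : f ∈ derivHardySpace p) : derivHardyNorm p f < ∞ :=
  ENNReal.add_lt_top.2 ⟨enorm_lt_top, hf.2.2⟩

lemma secondDerivHardyNorm_lt_top (hf : f ∈ secondDerivHardySpace p) :
    secondDerivHardyNorm p f < ∞ :=
  ENNReal.add_lt_top.2 ⟨ENNReal.add_lt_top.2 ⟨enorm_lt_top, enorm_lt_top⟩, hf.2.2⟩

lemma zero_mem_hardySpace (hp : 0 < p) : 0 ∈ hardySpace p := by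
  have hzero : (0 : ℂ → ℂ) ∈ analyticOnDisc := differentiableOn_const 0
  exact ⟨hzero, (hardyNorm_le_hardyNormTop hp hzero).trans_lt (by simp [hardyNormTop])⟩

lemma one_mem_derivHardySpace (hp : 0 < p) : 1 ∈ derivHardySpace p :=
  ⟨differentiableOn_const 1, by simpa using zero_mem_hardySpace hp⟩

lemma one_mem_secondDerivHardySpace (hp : 0 < p) : 1 ∈ secondDerivHardySpace p :=
  ⟨differentiableOn_const 1, by simpa using zero_mem_hardySpace hp⟩

end Embeddings

section IsBoundedBetween

variable {X Y Z : Set (ℂ → ℂ)} {NX NY NZ : (ℂ → ℂ) → ℝ≥0∞} {S T : (ℂ → ℂ) → (ℂ → ℂ)} {p : ℝ}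

lemma IsBoundedBetween.of_le {C : ℝ≥0} (hX : ∀ f ∈ X, NX f < ∞)
    (hY : ∀ f ∈ X, NY (T f) < ∞ → T f ∈ Y) (hle : ∀ f ∈ X, NY (T f) ≤ C * NX f) :
    IsBoundedBetween X NX Y NY T :=
  ⟨fun f hf => hY f hf ((hle f hf).trans_lt (ENNReal.mul_lt_top ENNReal.coe_lt_top (hX f hf))),
    C, hle⟩

lemma IsBoundedBetween.comp (hT : IsBoundedBetween Y NY Z NZ T)
    (hS : IsBoundedBetween X NX Y NY S) : IsBoundedBetween X NX Z NZ (T ∘ S) := by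
  obtain ⟨hT_maps, C, hC⟩ := hT
  obtain ⟨hS_maps, D, hD⟩ := hS
  refine ⟨fun f hf => hT_maps _ (hS_maps f hf), C * D, fun f hf => ?_⟩
  calc NZ (T (S f)) ≤ C * NY (S f) := hC _ (hS_maps f hf)
    _ ≤ C * (D * NX f) := by grw [hD f hf]
    _ = (C * D : ℝ≥0) * NX f := by rw [ENNReal.coe_mul, mul_assoc]

lemma isBoundedBetween_derivHardySpace_hardySpaceTop (hp : 1 ≤ p) :
    IsBoundedBetween (derivHardySpace p) (derivHardyNorm p) hardySpaceTop hardyNormTop id :=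
  .of_le (fun _ => derivHardyNorm_lt_top) (fun _ hf h => ⟨hf.1, h⟩)
    fun _ hf => hardyNormTop_le_derivHardyNorm hp hf.1

lemma isBoundedBetween_secondDerivHardySpace_derivHardySpace (hp : 1 ≤ p) :
    IsBoundedBetween (secondDerivHardySpace p) (secondDerivHardyNorm p)
      (derivHardySpace p) (derivHardyNorm p) id :=
  .of_le (fun _ => secondDerivHardyNorm_lt_top)
    (fun _ hf h => ⟨hf.1, deriv_mem_analyticOnDisc hf.1, le_add_self.trans_lt h⟩)
    fun _ hf => derivHardyNorm_le_secondDerivHardyNorm hp hf.1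

lemma weightedComp_one (φ ψ : ℂ → ℂ) : weightedComp φ ψ 1 = ψ :=
  funext fun z => mul_one (ψ z)

variable {φ ψ : ℂ → ℂ}

lemma isBoundedBetween_weightedComp_hardySpaceTop (hp : 0 < p) (hφ : φ ∈ analyticOnDisc)
    (hφ_maps : MapsTo φ unitDisc unitDisc) (hψ : ψ ∈ hardySpace p) :
    IsBoundedBetween hardySpaceTop hardyNormTop (hardySpace p) (hardyNorm p)
      (weightedComp φ ψ) := by
  have hcomp (f) (hf : f ∈ hardySpaceTop) : f ∘ φ ∈ analyticOnDisc :=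
    DifferentiableOn.comp hf.1 hφ hφ_maps
  refine .of_le (C := (hardyNorm p ψ).toNNReal) (fun f hf => hf.2)
    (fun f hf h => ⟨DifferentiableOn.mul hψ.1 (hcomp f hf), h⟩) fun f hf => ?_
  calc hardyNorm p (ψ * (f ∘ φ)) ≤ hardyNorm p ψ * hardyNormTop (f ∘ φ) :=
        hardyNorm_mul_le hp hψ.1 (hcomp f hf)
    _ ≤ (hardyNorm p ψ).toNNReal * hardyNormTop f := by
        rw [ENNReal.coe_toNNReal hψ.2.ne]
        grw [hardyNormTop_comp_le hφ_maps f]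

lemma isBoundedBetween_weightedComp_iff (hp : 0 < p) (hφ : φ ∈ analyticOnDisc)
    (hφ_maps : MapsTo φ unitDisc unitDisc) (h_one : 1 ∈ X)
    (hX : IsBoundedBetween X NX hardySpaceTop hardyNormTop id) :
    IsBoundedBetween X NX (hardySpace p) (hardyNorm p) (weightedComp φ ψ) ↔ ψ ∈ hardySpace p :=
  ⟨fun h => weightedComp_one φ ψ ▸ h.1 1 h_one,
    fun hψ => (isBoundedBetween_weightedComp_hardySpaceTop hp hφ hφ_maps hψ).comp hX⟩

end IsBoundedBetween

theorem lemma2p2 (p : ℝ) (hp : 1 ≤ p) (φ ψ : ℂ → ℂ)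
    (hφ : φ ∈ analyticOnDisc) (hφ_maps : Set.MapsTo φ unitDisc unitDisc)
    (hψ : ψ ∈ analyticOnDisc) :
    (IsBoundedBetween (secondDerivHardySpace p) (secondDerivHardyNorm p)
        (hardySpace p) (hardyNorm p) (weightedComp φ ψ) ↔ ψ ∈ hardySpace p) ∧
    (IsBoundedBetween (derivHardySpace p) (derivHardyNorm p)
        (hardySpace p) (hardyNorm p) (weightedComp φ ψ) ↔ ψ ∈ hardySpace p) := by
  have hS : IsBoundedBetween (derivHardySpace p) (derivHardyNorm p) hardySpaceTop hardyNormTop id :=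
    isBoundedBetween_derivHardySpace_hardySpaceTop hp
  have hS₂ : IsBoundedBetween (secondDerivHardySpace p) (secondDerivHardyNorm p)
      hardySpaceTop hardyNormTop id :=
    hS.comp (isBoundedBetween_secondDerivHardySpace_derivHardySpace hp)
  have hp₀ : 0 < p := one_pos.trans_le hp
  exact ⟨isBoundedBetween_weightedComp_iff hp₀ hφ hφ_maps (one_mem_secondDerivHardySpace hp₀) hS₂,
    isBoundedBetween_weightedComp_iff hp₀ hφ hφ_maps (one_mem_derivHardySpace hp₀) hS⟩
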